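/- Let $n\ge 1$ and $\Lambda\ge 1$. Let $|\cdot|$ denote the spectral norm of a real $n\times n$ matrix, let $\langle f\rangle_B=\frac1{|B|}\int_B f\,dx$, and let $\log$ be the inverse of the matrix exponential, as a map from the positive definite to the symmetric matrices. A matrix-valued weight is a measurable map $\mathbb A$ from $\mathbb R^n$ into the symmetric positive semidefinite matrices that is positive definite almost everywhere; put $\mu(x)=|\mathbb A(x)|$ and $\mu(B)=\int_B\mu\,dx$. For $U\subset\mathbb R^n$ set $$|\log\mathbb A|_{\mathrm{BMO}(U)}=\sup_{B'\subset U}\frac1{|B'|}\int_{B'}\bigl|\log\mathbb A-\langle\log\mathbb A\rangle_{B'}\bigr|\,dx,\qquad |\mathbb A|_{\mathrm{BMO}^2_\mu(U)}=\sup_{B'\subset U}\Bigl(\frac1{\mu(B')}\int_{B'}|\mathbb A-\langle\mathbb A\rangle_{B'}|^2\,\mu^{-1}\,dx\Bigr)^{1/2},$$ the suprema being over all open balls $B'\subset U$; the index $U$ is omitted for $U=\mathbb R^n$. Then there are constants $\delta>0$ and $c>0$, depending only on $n$ and $\Lambda$, with the following property. Let $\mathbb A$ be a matrix-valued weight with $|\mathbb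 A(x)|\,|\mathbb A(x)^{-1}|\le\Lambda^2$ for almost every $x$, such that $\log\mathbb A$ is locally integrable and $|\log\mathbb A|_{\mathrm{BMO}}\le\delta$. Then $\mathbb A$ is locally integrable, and for every ball $B\subset\mathbb R^n$ $$\Bigl(\frac{|B|}{\mu(B)}\cdot\frac1{|B|}\int_B|\mathbb A-\langle\mathbb A\rangle_B|^2\,\mu^{-1}\,dx\Bigr)^{1/2}\le c\,|\log\mathbb A|_{\mathrm{BMO}(B)} .$$ In particular, $|\mathbb A|_{\mathrm{BMO}^2_\mu(B)}\le c\,|\log\mathbb A|_{\mathrm{BMO}(B)}$ for every ball $B$, and $|\mathbb A|_{\mathrm{BMO}^2_\mu}\le c\,|\log\mathbb A|_{\mathrm{BMO}}$. -/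

import Mathlib

open MeasureTheory Metric
open scoped ENNReal Matrix.Norms.L2Operator

/- Throughout, matrices carry the spectral norm `‖L‖ = sup_{|ξ| ≤ 1} |L ξ|` (the operator norm with
respect to the Euclidean norm), and `CFC.log` is the logarithm of a matrix given by the functional
calculus; on positive definite matrices it is the inverse of the matrix exponential. -/

/-- A matrix-valued weight on `ℝⁿ`: a measurable map into the symmetric positive semidefinite
matrices which is positive definite almost everywhere. -/
structure IsMatrixWeight {n : ℕ}
    (A : EuclideanSpace ℝ (Fin n) → Matrix (Fin n) (Fin n) ℝ) : Prop where
  aestronglyMeasurable : AEStronglyMeasurable A volume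
  posSemidef : ∀ x, (A x).PosSemidef
  posDef_ae : ∀ᵐ x, (A x).PosDef

/-- The pointwise logarithm `log A` of a matrix-valued weight. -/
noncomputable def logWeight {n : ℕ}
    (A : EuclideanSpace ℝ (Fin n) → Matrix (Fin n) (Fin n) ℝ) :
    EuclideanSpace ℝ (Fin n) → Matrix (Fin n) (Fin n) ℝ :=
  fun x => CFC.log (A x)

/-- The BMO seminorm on `U`: the supremum over all balls `B ⊆ U` of the mean oscillation
`⨍_B |f - ⟨f⟩_B| dx`, for a locally integrable `f`. -/
noncomputable def bmoSeminorm {n : ℕ} (f : EuclideanSpace ℝ (Fin n) → Matrix (Fin n) (Fin n) ℝ)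
    (U : Set (EuclideanSpace ℝ (Fin n))) : ℝ≥0∞ :=
  ⨆ (y : EuclideanSpace ℝ (Fin n)) (r : ℝ) (_ : 0 < r) (_ : ball y r ⊆ U),
    ⨍⁻ x in ball y r, ‖f x - ⨍ z in ball y r, f z‖ₑ ∂volume

/-- `μ(S) = ∫_S μ dx` for the scalar weight `μ = |A|`. -/
noncomputable def normWeightMass {n : ℕ}
    (A : EuclideanSpace ℝ (Fin n) → Matrix (Fin n) (Fin n) ℝ)
    (S : Set (EuclideanSpace ℝ (Fin n))) : ℝ≥0∞ :=
  ∫⁻ x in S, ‖A x‖ₑ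

/-- The weighted seminorm `BMO²_μ` on `U`, with `μ = |A|`: the supremum over all balls `B ⊆ U` of
`(1/μ(B) ∫_B |A - ⟨A⟩_B|² μ⁻¹ dx)^(1/2)`, for a locally integrable weight `A`. -/
noncomputable def weightedBMOTwo {n : ℕ}
    (A : EuclideanSpace ℝ (Fin n) → Matrix (Fin n) (Fin n) ℝ)
    (U : Set (EuclideanSpace ℝ (Fin n))) : ℝ≥0∞ :=
  ⨆ (y : EuclideanSpace ℝ (Fin n)) (r : ℝ) (_ : 0 < r) (_ : ball y r ⊆ U),
    (1 / normWeightMass A (ball y r) *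
      ∫⁻ x in ball y r, ‖A x - ⨍ z in ball y r, A z‖ₑ ^ 2 * ‖A x‖ₑ⁻¹) ^ (1 / 2 : ℝ)

/-! Write `A = exp H` with `H = log A`, let `h` be the mean of `H` over a ball `B`, `α = ‖exp h‖`
and `u = ‖H - h‖`. For self-adjoint matrices the logarithm of `‖exp ·‖` is the largest eigenvalue,
which is 1-Lipschitz, so `α exp (-u) ≤ ‖A‖ ≤ α exp u`; Duhamel's formula gives `‖A - exp h‖ ≤ α u
exp u`. These bounds do not need `H` and `h` to commute. Consequently `‖A - exp h‖² ‖A‖⁻¹ ≤ α u² exp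
(3u)`, and replacing `exp h` by the mean of `A` costs an error of the same order. The mass `μ(B)` is
at least `α |B| / 2` once the mean of `u` is at most `1/2`. So everything reduces to exponential
integrability of `u`: if the oscillation of `H` is at most a small `N`, then `u² exp (3u)` is at
most a constant times `N² exp (a u / N)`, whose mean is bounded by John–Nirenberg.

Since the right-hand side involves only balls inside `B`, John–Nirenberg is needed in a local form
(`exists_lintegral_exp_le_of_oscLeOne`). A Calderón–Zygmund stopping argument with balls treats
balls whose double is admissible. The full ball is then recovered by averaging over Whitney balls:
their means drift from the mean over `B` only logarithmically in the distance to the boundary, so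
after exponentiation with a small exponent the loss is an integrable power of that distance. -/

section ExpPerturbation

/-! ### Perturbation of exponentials of self-adjoint elements. -/

variable {𝔸 : Type*} [NormedRing 𝔸] [StarRing 𝔸] [NormedAlgebra ℝ 𝔸]
  [IsometricContinuousFunctionalCalculus ℝ 𝔸 IsSelfAdjoint] [PartialOrder 𝔸] [StarOrderedRing 𝔸]
  [NonnegSpectrumClass ℝ 𝔸] [StarModule ℝ 𝔸] [Nontrivial 𝔸]

/-- The norm of `exp (s • a)` is governed by the largest spectral value of `a`. -/
lemma exists_norm_exp_smul_eq {a : 𝔸} (ha : IsSelfAdjoint a) :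
    ∃ M : ℝ, (∀ s : ℝ, 0 ≤ s → ‖NormedSpace.exp (s • a)‖ = Real.exp (s * M)) ∧
      ∀ c : ℝ, M ≤ c ↔ a ≤ algebraMap ℝ 𝔸 c := by
  have hne : (spectrum ℝ a).Nonempty := ContinuousFunctionalCalculus.spectrum_nonempty a ha
  obtain ⟨M, hM, hmax⟩ :=
    (ContinuousFunctionalCalculus.isCompact_spectrum (R := ℝ) a).exists_isMaxOn hne continuousOn_id
  refine ⟨M, fun s hs => ?_, fun c => ?_⟩
  · have hexp : NormedSpace.exp (s • a) = cfc (fun x => Real.exp (s * x)) a := by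
      rw [← CFC.real_exp_eq_normedSpace_exp ((IsSelfAdjoint.all s).smul ha),
        ← cfc_comp_smul s Real.exp a]
      rfl
    rw [hexp]
    apply le_antisymm
    · refine norm_cfc_le (Real.exp_pos _).le fun x hx => ?_
      rw [Real.norm_of_nonneg (Real.exp_pos _).le, Real.exp_le_exp]
      exact mul_le_mul_of_nonneg_left (hmax hx) hs
    · have := norm_apply_le_norm_cfc (fun x => Real.exp (s * x)) a hM
      rwa [Real.norm_of_nonneg (Real.exp_pos _).le] at this
  · rw [le_algebraMap_iff_spectrum_le ha]
    exact ⟨fun h x hx => (hmax hx).trans h, fun h => h M hM⟩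

/-- For self-adjoint `a` and `b`, `‖exp a‖ ≤ exp ‖a - b‖ ‖exp b‖`; the exponents `s ∈ [0, 1]`
interpolate. -/
lemma norm_exp_smul_le {a b : 𝔸} (ha : IsSelfAdjoint a) (hb : IsSelfAdjoint b) {s : ℝ}
    (hs : 0 ≤ s) :
    ‖NormedSpace.exp (s • a)‖ ≤ Real.exp (s * ‖a - b‖) * ‖NormedSpace.exp (s • b)‖ := by
  obtain ⟨M, hM, hMc⟩ := exists_norm_exp_smul_eq ha
  obtain ⟨N, hN, hNc⟩ := exists_norm_exp_smul_eq hb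
  -- In the order of self-adjoint elements, `a ≤ b + ‖a - b‖`; hence the largest spectral values
  -- differ by at most `‖a - b‖`.
  have hab : a - b ≤ algebraMap ℝ 𝔸 ‖a - b‖ :=
    le_algebraMap_of_spectrum_le (fun x hx => (Real.le_norm_self x).trans
      (IsometricContinuousFunctionalCalculus.norm_spectrum_le (a - b) hx (ha.sub hb))) (ha.sub hb)
  have hMN : M ≤ ‖a - b‖ + N := by
    rw [hMc, map_add]
    calc a = (a - b) + b := by abel
      _ ≤ _ := add_le_add hab ((hNc N).1 le_rfl)
  rw [hM s hs, hN s hs, ← Real.exp_add, Real.exp_le_exp, ← mul_add]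
  exact mul_le_mul_of_nonneg_left hMN hs

lemma norm_exp_le {a b : 𝔸} (ha : IsSelfAdjoint a) (hb : IsSelfAdjoint b) :
    ‖NormedSpace.exp a‖ ≤ Real.exp ‖a - b‖ * ‖NormedSpace.exp b‖ := by
  simpa using norm_exp_smul_le ha hb zero_le_one

/-- Perturbation bound for the exponential of self-adjoint elements. -/
lemma norm_exp_sub_exp_le [CompleteSpace 𝔸] {a b : 𝔸} (ha : IsSelfAdjoint a)
    (hb : IsSelfAdjoint b) :
    ‖NormedSpace.exp a - NormedSpace.exp b‖
      ≤ ‖a - b‖ * Real.exp ‖a - b‖ * ‖NormedSpace.exp b‖ := by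
  obtain ⟨N, hN, -⟩ := exists_norm_exp_smul_eq hb
  -- Duhamel's path, running from `exp b` at `0` to `exp a` at `1`.
  have hder : ∀ s ∈ Set.Icc (0 : ℝ) 1, HasDerivWithinAt
      (fun u : ℝ => NormedSpace.exp (u • a) * NormedSpace.exp ((1 - u) • b))
      (NormedSpace.exp (s • a) * (a - b) * NormedSpace.exp ((1 - s) • b)) (Set.Icc 0 1) s := by
    intro s _
    have h1 := hasDerivAt_exp_smul_const a s
    have h2 : HasDerivAt (fun u : ℝ => NormedSpace.exp ((1 - u) • b))
        (-(b * NormedSpace.exp ((1 - s) • b))) s := by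
      simpa [Function.comp_def] using
        (hasDerivAt_exp_smul_const' b (1 - s)).scomp s ((hasDerivAt_id s).const_sub 1)
    refine ((h1.mul h2).congr_deriv ?_).hasDerivWithinAt
    noncomm_ring
  have hbound : ∀ s ∈ Set.Icc (0 : ℝ) 1,
      ‖NormedSpace.exp (s • a) * (a - b) * NormedSpace.exp ((1 - s) • b)‖
        ≤ ‖a - b‖ * Real.exp ‖a - b‖ * ‖NormedSpace.exp b‖ := by
    intro s hs
    have h1 := norm_exp_smul_le ha hb hs.1
    rw [hN s hs.1] at h1
    have h2 := hN (1 - s) (by linarith [hs.2])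
    have h3 : ‖NormedSpace.exp b‖ = Real.exp N := by simpa using hN 1 zero_le_one
    calc _ ≤ ‖NormedSpace.exp (s • a)‖ * ‖a - b‖ * ‖NormedSpace.exp ((1 - s) • b)‖ :=
          (norm_mul_le _ _).trans (mul_le_mul_of_nonneg_right (norm_mul_le _ _) (norm_nonneg _))
      _ ≤ (Real.exp (s * ‖a - b‖) * Real.exp (s * N)) * ‖a - b‖ * Real.exp ((1 - s) * N) := by
          rw [h2]; gcongr
      -- Because `‖exp (s • b)‖ = exp (s N)` exactly, the exponents `s` and `1 - s` recombine into a
      -- single factor `‖exp b‖`.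
      _ = ‖a - b‖ * Real.exp (s * ‖a - b‖) * Real.exp N := by
          rw [show Real.exp N = Real.exp (s * N) * Real.exp ((1 - s) * N) by
            rw [← Real.exp_add]; ring_nf]
          ring
      _ ≤ ‖a - b‖ * Real.exp ‖a - b‖ * ‖NormedSpace.exp b‖ := by
          rw [h3]
          gcongr
          exact mul_le_of_le_one_left (norm_nonneg _) hs.2
  simpa using (convex_Icc (0 : ℝ) 1).norm_image_sub_le_of_norm_hasDerivWithin_le hder hbound
    (Set.left_mem_Icc.2 zero_le_one) (Set.right_mem_Icc.2 zero_le_one)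

end ExpPerturbation

/-! ### Means over balls and the local John–Nirenberg inequality. -/

section JohnNirenberg

open Module (finrank)
open scoped NNReal

/-- Jensen's inequality without division. It serves both to compare means over nested balls and,
read backwards, to bound the measure of balls whose mean is far from `c`. -/
lemma enorm_setAverage_sub_mul_le {V E : Type*} [MeasurableSpace V] (μ : Measure V)
    [NormedAddCommGroup E] [NormedSpace ℝ E] [CompleteSpace E] {f : V → E} {S : Set V}
    (hf : IntegrableOn f S μ) (hS : μ S ≠ ∞) (c : E) :
    ‖(⨍ z in S, f z ∂μ) - c‖ₑ * μ S ≤ ∫⁻ x in S, ‖f x - c‖ₑ ∂μ := by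
  have h : μ.real S • ((⨍ z in S, f z ∂μ) - c) = ∫ x in S, (f x - c) ∂μ := by
    rw [smul_sub, measure_smul_setAverage f hS, integral_sub hf (integrableOn_const hS),
      setIntegral_const]
  calc ‖(⨍ z in S, f z ∂μ) - c‖ₑ * μ S = ‖μ.real S • ((⨍ z in S, f z ∂μ) - c)‖ₑ := by
        rw [enorm_smul, mul_comm, Real.enorm_of_nonneg measureReal_nonneg, measureReal_def,
          ENNReal.ofReal_toReal hS]
    _ ≤ _ := by rw [h]; exact enorm_integral_le_lintegral_enorm _

lemma MeasureTheory.LocallyIntegrable.integrableOn_ball {V E : Type*} [PseudoMetricSpace V]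
    [ProperSpace V] [MeasurableSpace V] {μ : Measure V} [NormedAddCommGroup E] {f : V → E}
    (hf : LocallyIntegrable f μ) (x : V) (r : ℝ) : IntegrableOn f (ball x r) μ :=
  (hf.integrableOn_isCompact (isCompact_closedBall x r)).mono_set ball_subset_closedBall

variable {V E : Type*} [NormedAddCommGroup V] [NormedSpace ℝ V] [FiniteDimensional ℝ V]
  [MeasurableSpace V] [BorelSpace V] (μ : Measure V) [μ.IsAddHaarMeasure]
  [NormedAddCommGroup E] [NormedSpace ℝ E] [CompleteSpace E]

/-- The mean oscillation of `f` over every ball contained in `U` is at most one. -/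
def OscLeOne (f : V → E) (U : Set V) : Prop :=
  ∀ (y : V) (r : ℝ), 0 < r → ball y r ⊆ U →
    ∫⁻ x in ball y r, ‖f x - ⨍ z in ball y r, f z ∂μ‖ₑ ∂μ ≤ μ (ball y r)

lemma measure_ball_natCast_mul (x y : V) {c : ℕ} (hc : c ≠ 0) (s : ℝ) :
    μ (ball x (c * s)) = (c : ℝ≥0∞) ^ finrank ℝ V * μ (ball y s) := by
  have hc' : (0 : ℝ) < c := by exact_mod_cast Nat.pos_of_ne_zero hc
  rw [Measure.addHaar_ball_mul_of_pos μ x hc' s, Measure.addHaar_ball_center μ y,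
    ENNReal.ofReal_pow hc'.le, ENNReal.ofReal_natCast]

lemma measure_ball_le_natCast_pow_mul (x y : V) {c : ℕ} (hc : c ≠ 0) {r s : ℝ} (h : r ≤ c * s) :
    μ (ball x r) ≤ (c : ℝ≥0∞) ^ finrank ℝ V * μ (ball y s) :=
  (measure_mono (ball_subset_ball h)).trans (measure_ball_natCast_mul μ x y hc s).le

/-- Comparison of the means over two nested balls. -/
lemma OscLeOne.norm_setAverage_sub_le {f : V → E} {U : Set V} (hf : LocallyIntegrable f μ)
    (h : OscLeOne μ f U) {x y : V} {s r : ℝ} (hs : 0 < s) (hr : 0 < r)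
    (hxy : ball x s ⊆ ball y r) (hU : ball y r ⊆ U) {c : ℕ} (hc : c ≠ 0) (hrs : r ≤ c * s) :
    ‖(⨍ z in ball x s, f z ∂μ) - ⨍ z in ball y r, f z ∂μ‖ ≤ (c : ℝ) ^ finrank ℝ V := by
  have hpos := measure_ball_pos μ x hs
  have h1 := enorm_setAverage_sub_mul_le μ (S := ball x s) (hf.integrableOn_ball x s)
    measure_ball_lt_top.ne (⨍ z in ball y r, f z ∂μ)
  have h2 := h1.trans ((lintegral_mono_set hxy).trans ((h y r hr hU).trans
    (measure_ball_le_natCast_pow_mul μ y x hc hrs)))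
  have h3 := (ENNReal.mul_le_mul_iff_left hpos.ne' measure_ball_lt_top.ne).1 h2
  rw [← ofReal_norm, ← ENNReal.ofReal_natCast, ← ENNReal.ofReal_pow (by positivity)] at h3
  exact (ENNReal.ofReal_le_ofReal_iff (by positivity)).1 h3

/-! ### Stopping balls and the exponential bound in the interior. -/

/-- Lebesgue differentiation along dyadic open balls. -/
lemma ae_tendsto_setAverage_ball [Nontrivial V] {f : V → E} (hf : LocallyIntegrable f μ) {s : ℝ}
    (hs : 0 < s) : ∀ᵐ x ∂μ, Filter.Tendsto
      (fun k : ℕ => ⨍ z in ball x (s * (1 / 2) ^ k), f z ∂μ) Filter.atTop (nhds (f x)) := by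
  filter_upwards [IsUnifLocDoublingMeasure.ae_tendsto_average μ hf 1] with x hx
  have hδ : Filter.Tendsto (fun k : ℕ => s * (1 / 2 : ℝ) ^ k) Filter.atTop
      (nhdsWithin 0 (Set.Ioi 0)) := by
    refine tendsto_nhdsWithin_iff.2 ⟨?_, Filter.Eventually.of_forall fun k => by
      simp only [Set.mem_Ioi]; positivity⟩
    simpa using (tendsto_pow_atTop_nhds_zero_of_lt_one (by norm_num : (0 : ℝ) ≤ 1 / 2)
      (by norm_num)).const_mul s
  refine (hx (fun _ => x) _ hδ (Filter.Eventually.of_forall fun k => ?_)).congr fun k => ?_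
  · exact mem_closedBall_self (by positivity)
  · refine setAverage_congr (ae_eq_of_subset_of_measure_ge ball_subset_closedBall
      (Measure.addHaar_closedBall_eq_addHaar_ball μ _ _).le measurableSet_ball.nullMeasurableSet
      measure_closedBall_lt_top.ne).symm

/-- Calderón–Zygmund stopping balls for the oscillation of `f` on a ball. -/
lemma OscLeOne.exists_stopping_balls [Nontrivial V] {f : V → E} {U : Set V}
    (hf : LocallyIntegrable f μ) (h : OscLeOne μ f U) {x₀ : V} {s : ℝ} (hs : 0 < s)
    (hU : ball x₀ (2 * s) ⊆ U) :
    ∃ (u : Set V) (ρ : V → ℝ), u.Countable ∧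
      (∀ x ∈ u, 0 < ρ x ∧ ball x (2 * ρ x) ⊆ U ∧
        ‖(⨍ z in ball x (ρ x), f z ∂μ) - ⨍ z in ball x₀ s, f z ∂μ‖
          ≤ 4 * 32 ^ finrank ℝ V) ∧
      (∑' x : u, μ (ball (x : V) (ρ x))) ≤ 2⁻¹ * μ (ball x₀ s) ∧
      ∀ᵐ x ∂μ, x ∈ ball x₀ s → (x ∈ ⋃ y ∈ u, ball y (ρ y)) ∨
        ‖f x - ⨍ z in ball x₀ s, f z ∂μ‖ ≤ 4 * 32 ^ finrank ℝ V := by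
  classical
  set D := finrank ℝ V with hD
  set m := ⨍ z in ball x₀ s, f z ∂μ with hm
  -- The threshold is `(2 * 4 ^ D) * (2 * 8 ^ D)`: the first factor bounds the oscillation integral
  -- over the doubled ball, `8 ^ D` pays for enlarging the stopping balls, and the last `2` yields
  -- the gain `2⁻¹` in measure.
  set L : ℝ := 4 * 32 ^ D with hL
  let P : V → ℕ → Prop := fun x k => L < ‖(⨍ z in ball x (s * (1 / 2) ^ k), f z ∂μ) - m‖
  let G : Set V := {x | x ∈ ball x₀ s ∧ ∃ k, P x k}
  -- The stopping index, i.e. the largest dyadic radius whose mean is too far from `m`; the default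
  -- `0` is irrelevant, since `κ` is only used on `G`.
  let κ : V → ℕ := fun x => if hx : ∃ k, P x k then Nat.find hx else 0
  have hκ : ∀ x ∈ G, P x (κ x) := fun x hx => by
    simp only [κ, dif_pos hx.2]; exact Nat.find_spec hx.2
  have hκmin : ∀ x ∈ G, ∀ k < κ x, ¬ P x k := fun x hx k hk => by
    simp only [κ, dif_pos hx.2] at hk; exact Nat.find_min hx.2 hk
  have h32 : (1 : ℝ) ≤ 32 ^ D := one_le_pow₀ (by norm_num)
  have hsub : ∀ x ∈ ball x₀ s, ∀ k : ℕ, ball x (s * (1 / 2) ^ k) ⊆ ball x₀ (2 * s) := by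
    intro x hx k
    apply ball_subset_ball'
    have : s * (1 / 2 : ℝ) ^ k ≤ s * 1 := by
      gcongr; exact pow_le_one₀ (by norm_num) (by norm_num)
    linarith [mem_ball.1 hx]
  have hm2 : ‖m - ⨍ z in ball x₀ (2 * s), f z ∂μ‖ ≤ (2 : ℕ) ^ D :=
    h.norm_setAverage_sub_le μ hf hs (by positivity) (ball_subset_ball (by linarith)) hU
      two_ne_zero (by norm_num)
  -- For indices at most `3` the radius is comparable to `2 * s`, so the mean has moved by at most
  -- `16 ^ D + 2 ^ D < L`. Having `κ ≥ 4` keeps the doubles of the eightfold balls, of radius `16 *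
  -- 2 ^ (-κ) * s ≤ s`, inside `U`.
  have hκ4 : ∀ x ∈ G, 4 ≤ κ x := by
    intro x hx
    by_contra hlt
    have hk3 : κ x ≤ 3 := by omega
    have hhalf : (1 / 8 : ℝ) ≤ (1 / 2) ^ κ x := by
      calc (1 / 8 : ℝ) = (1 / 2) ^ 3 := by norm_num
        _ ≤ _ := pow_le_pow_of_le_one (by norm_num) (by norm_num) hk3
    have h1 : ‖(⨍ z in ball x (s * (1 / 2) ^ κ x), f z ∂μ) - ⨍ z in ball x₀ (2 * s), f z ∂μ‖
        ≤ (16 : ℕ) ^ D :=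
      h.norm_setAverage_sub_le μ hf (by positivity) (by positivity) (hsub x hx.1 _) hU
        (by norm_num) (by push_cast; nlinarith)
    have h2 := hκ x hx
    have h3 := norm_sub_le_norm_sub_add_norm_sub (⨍ z in ball x (s * (1 / 2) ^ κ x), f z ∂μ)
      (⨍ z in ball x₀ (2 * s), f z ∂μ) m
    rw [norm_sub_rev (⨍ z in ball x₀ (2 * s), f z ∂μ) m] at h3
    have h4 : ((16 : ℕ) : ℝ) ^ D ≤ 32 ^ D := by push_cast; gcongr; norm_num
    have h5 : ((2 : ℕ) : ℝ) ^ D ≤ 32 ^ D := by push_cast; gcongr; norm_num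
    refine absurd (h3.trans (add_le_add h1 hm2)) (not_le.2 (lt_of_le_of_lt ?_ h2))
    rw [hL]
    linarith
  have hρs : ∀ x ∈ G, s * (1 / 2 : ℝ) ^ κ x ≤ s := fun x _ =>
    mul_le_of_le_one_right hs.le (pow_le_one₀ (by norm_num) (by norm_num))
  obtain ⟨u, huG, hdisj, hcov⟩ := Vitali.exists_disjoint_subfamily_covering_enlargement_closedBall
    G (fun x => x) (fun x => s * (1 / 2 : ℝ) ^ κ x) s hρs 5 (by norm_num)
  have hdisj' : u.PairwiseDisjoint fun x => ball x (s * (1 / 2 : ℝ) ^ κ x) :=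
    hdisj.mono fun x => ball_subset_closedBall
  have hcount : u.Countable := hdisj'.countable_of_isOpen (fun _ _ => isOpen_ball)
    fun x _ => ⟨x, mem_ball_self (by positivity)⟩
  have height : ∀ x ∈ G, 8 * (s * (1 / 2 : ℝ) ^ κ x) = s * (1 / 2) ^ (κ x - 3) := by
    intro x hx
    have := hκ4 x hx
    obtain ⟨j, hj⟩ : ∃ j, κ x = j + 3 := ⟨κ x - 3, by omega⟩
    rw [hj, Nat.add_sub_cancel, pow_add]; ring
  -- Vitali needs only the factor `5`. The factor `8 = 2 ^ 3` makes the radius dyadic again, at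
  -- index `κ x - 3`, where minimality of `κ` bounds the mean; the strict inequality `5 < 8` absorbs
  -- the passage to open balls.
  refine ⟨u, fun x => 8 * (s * (1 / 2 : ℝ) ^ κ x), hcount, fun x hx => ⟨by positivity, ?_, ?_⟩,
    ?_, ?_⟩
  · have hxG := huG hx
    have h4 := hκ4 x hxG
    refine subset_trans (ball_subset_ball ?_) ((hsub x hxG.1 0).trans hU)
    have : (1 / 2 : ℝ) ^ κ x ≤ (1 / 2) ^ 4 :=
      pow_le_pow_of_le_one (by norm_num) (by norm_num) h4
    norm_num at this ⊢
    nlinarith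
  · have hxG := huG hx
    have h4 := hκ4 x hxG
    simp only [height x hxG]
    exact not_lt.1 (hκmin x hxG (κ x - 3) (by omega))
  · have hB := measure_ball_pos μ x₀ hs
    have hBt : μ (ball x₀ s) ≠ ∞ := measure_ball_lt_top.ne
    have h1 : ∀ x : u, ENNReal.ofReal L * μ (ball (x : V) (s * (1 / 2) ^ κ x))
        ≤ ∫⁻ z in ball (x : V) (s * (1 / 2) ^ κ x), ‖f z - m‖ₑ ∂μ := by
      intro x
      refine le_trans ?_ (enorm_setAverage_sub_mul_le μ (hf.integrableOn_ball _ _)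
        measure_ball_lt_top.ne m)
      gcongr
      rw [← ofReal_norm]
      exact ENNReal.ofReal_le_ofReal (hκ x (huG x.2)).le
    have h2 : ∑' x : u, ∫⁻ z in ball (x : V) (s * (1 / 2) ^ κ x), ‖f z - m‖ₑ ∂μ
        ≤ ∫⁻ z in ball x₀ (2 * s), ‖f z - m‖ₑ ∂μ := by
      rw [← lintegral_biUnion hcount (fun _ _ => measurableSet_ball) hdisj']
      exact lintegral_mono_set (Set.iUnion₂_subset fun x hx => hsub x (huG hx).1 _)
    have h3 : ∫⁻ z in ball x₀ (2 * s), ‖f z - m‖ₑ ∂μ ≤ 2 * 4 ^ D * μ (ball x₀ s) := by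
      set m₂ := ⨍ z in ball x₀ (2 * s), f z ∂μ with hm₂
      have hm2' : ‖m₂ - m‖ₑ ≤ 2 ^ D := by
        rw [← ofReal_norm, norm_sub_rev]
        refine (ENNReal.ofReal_le_ofReal hm2).trans ?_
        rw [ENNReal.ofReal_pow (by positivity)]; simp
      calc ∫⁻ z in ball x₀ (2 * s), ‖f z - m‖ₑ ∂μ
          ≤ ∫⁻ z in ball x₀ (2 * s), (‖f z - m₂‖ₑ + ‖m₂ - m‖ₑ) ∂μ := by
            refine lintegral_mono fun z => ?_
            rw [← sub_add_sub_cancel (f z) m₂ m]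
            exact enorm_add_le _ _
        _ = (∫⁻ z in ball x₀ (2 * s), ‖f z - m₂‖ₑ ∂μ) + ‖m₂ - m‖ₑ * μ (ball x₀ (2 * s)) := by
            rw [lintegral_add_right _ measurable_const, setLIntegral_const]
        _ ≤ μ (ball x₀ (2 * s)) + 2 ^ D * μ (ball x₀ (2 * s)) := by
            gcongr
            exact h x₀ (2 * s) (by positivity) hU
        _ ≤ 2 ^ D * μ (ball x₀ (2 * s)) + 2 ^ D * μ (ball x₀ (2 * s)) := by
            gcongr
            exact le_mul_of_one_le_left' (one_le_pow₀ (by norm_num))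
        _ = 2 * 4 ^ D * μ (ball x₀ s) := by
            have := measure_ball_natCast_mul μ x₀ x₀ (c := 2) two_ne_zero s
            push_cast at this
            rw [this, show (4 : ℝ≥0∞) = 2 * 2 by norm_num, mul_pow, ← hD]; ring
    have h4 : ENNReal.ofReal L * ∑' x : u, μ (ball (x : V) (s * (1 / 2) ^ κ x))
        ≤ 2 * 4 ^ D * μ (ball x₀ s) := by
      rw [← ENNReal.tsum_mul_left]
      exact (ENNReal.tsum_le_tsum h1).trans (h2.trans h3)
    have h5 : ∀ x : u, μ (ball (x : V) (8 * (s * (1 / 2) ^ κ x)))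
        = 8 ^ D * μ (ball (x : V) (s * (1 / 2) ^ κ x)) := fun x => by
      have := measure_ball_natCast_mul μ (x : V) x (c := 8) (by norm_num) (s * (1 / 2) ^ κ x)
      push_cast at this
      rw [this, ← hD]
    rw [tsum_congr h5, ENNReal.tsum_mul_left]
    have hLe : ENNReal.ofReal L = (2 * 4 ^ D) * (2 * 8 ^ D) := by
      rw [hL, ENNReal.ofReal_mul (by norm_num), ENNReal.ofReal_pow (by norm_num)]
      rw [show (32 : ℝ) = 4 * 8 by norm_num, ENNReal.ofReal_mul (by norm_num)]
      simp only [ENNReal.ofReal_ofNat]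
      rw [mul_pow, show (4 : ℝ≥0∞) = 2 * 2 by norm_num]; ring
    rw [hLe, mul_assoc (2 * 4 ^ D)] at h4
    have h6 := (ENNReal.mul_le_mul_iff_right (by positivity)
      (ENNReal.mul_ne_top (by norm_num) (ENNReal.pow_ne_top (by norm_num)))).1 h4
    rw [mul_assoc] at h6
    calc _ = 2⁻¹ * (2 * (8 ^ D * ∑' x : u, μ (ball (x : V) (s * (1 / 2) ^ κ x)))) := by
          rw [← mul_assoc 2⁻¹, ENNReal.inv_mul_cancel (by norm_num) (by norm_num), one_mul]
      _ ≤ _ := by gcongr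
  -- Off the stopping set every dyadic mean is within `L` of `m`, and so is the limit `f x` at
  -- Lebesgue points.
  · filter_upwards [ae_tendsto_setAverage_ball μ hf hs] with x hx hxB
    by_cases hxG : ∃ k, P x k
    · left
      obtain ⟨y, hy, hxy⟩ := hcov x ⟨hxB, hxG⟩
      refine Set.mem_iUnion₂.2 ⟨y, hy, ?_⟩
      have h1 := mem_closedBall.1 (hxy (mem_closedBall_self (by positivity)))
      have h2 : 0 < s * (1 / 2 : ℝ) ^ κ y := by positivity
      exact mem_ball.2 (by linarith)
    · right
      refine le_of_tendsto (hx.sub_const m).norm (Filter.Eventually.of_forall fun k => ?_)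
      exact not_lt.1 fun hk => hxG ⟨k, hk⟩

/-- The exponent in the John–Nirenberg inequality in dimension `D`. -/
noncomputable def jnExponent (D : ℕ) : ℝ := Real.log (3 / 2) / (4 * 32 ^ D)

lemma jnExponent_pos (D : ℕ) : 0 < jnExponent D :=
  div_pos (Real.log_pos (by norm_num)) (by positivity)

/-- Passing one generation of stopping balls costs the factor `3 / 2` while the measure halves; the
product `3 / 4 < 1` lets the recursion close. -/
lemma exp_jnExponent_mul (D : ℕ) : Real.exp (jnExponent D * (4 * 32 ^ D)) = 3 / 2 := by
  rw [jnExponent, div_mul_cancel₀ _ (by positivity), Real.exp_log (by norm_num)]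

lemma lintegral_eq_iSup_min {α : Type*} [MeasurableSpace α] {ν : Measure α} {g : α → ℝ≥0∞}
    (hg : AEMeasurable g ν) (hfin : ∀ x, g x ≠ ∞) :
    ∫⁻ x, g x ∂ν = ⨆ M : ℕ, ∫⁻ x, min (g x) M ∂ν := by
  rw [← lintegral_iSup' (fun M => hg.min aemeasurable_const)
    (Filter.Eventually.of_forall fun x => fun i j hij => by dsimp; gcongr)]
  refine lintegral_congr fun x => le_antisymm ?_ (iSup_le fun M => min_le_left _ _)
  obtain ⟨M, hM⟩ := ENNReal.exists_nat_gt (hfin x)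
  exact le_iSup_of_le M (le_min le_rfl hM.le)

/-- The exponential John–Nirenberg bound on balls whose double is contained in `U`. -/
lemma OscLeOne.lintegral_exp_le_of_double_subset [Nontrivial V] {f : V → E} {U : Set V}
    (hf : LocallyIntegrable f μ) (h : OscLeOne μ f U) {x₀ : V} {s : ℝ} (hs : 0 < s)
    (hU : ball x₀ (2 * s) ⊆ U) :
    ∫⁻ x in ball x₀ s, ENNReal.ofReal (Real.exp (jnExponent (finrank ℝ V) *
      ‖f x - ⨍ z in ball x₀ s, f z ∂μ‖)) ∂μ ≤ 6 * μ (ball x₀ s) := by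
  set D := finrank ℝ V
  set a := jnExponent D
  have ha : 0 < a := jnExponent_pos D
  let G : E → ℝ≥0∞ := fun v => ENNReal.ofReal (Real.exp (a * ‖v‖))
  have hGadd : ∀ (M : ℕ) (v w : E), ‖w‖ ≤ 4 * 32 ^ D →
      min (G (v + w)) M ≤ ((3 / 2 : ℝ≥0) : ℝ≥0∞) * min (G v) M := by
    intro M v w hw
    have h32 : ((3 / 2 : ℝ≥0) : ℝ≥0∞) = ENNReal.ofReal (3 / 2) := by
      rw [ENNReal.ofReal, Real.toNNReal_div (by norm_num)]; simp
    have h1 : G (v + w) ≤ ((3 / 2 : ℝ≥0) : ℝ≥0∞) * G v := by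
      rw [h32, ← ENNReal.ofReal_mul (by norm_num)]
      apply ENNReal.ofReal_le_ofReal
      rw [← exp_jnExponent_mul D, ← Real.exp_add, Real.exp_le_exp, ← mul_add]
      have := norm_add_le v w
      exact mul_le_mul_of_nonneg_left (by linarith) ha.le
    have h2 : (M : ℝ≥0∞) ≤ ((3 / 2 : ℝ≥0) : ℝ≥0∞) * M := by
      refine le_mul_of_one_le_left' ?_
      rw [h32, ← ENNReal.ofReal_one]
      exact ENNReal.ofReal_le_ofReal (by norm_num)
    rw [mul_min]
    exact min_le_min h1 h2
  have hmeas : ∀ m : E, AEMeasurable (fun x => G (f x - m)) μ := fun m =>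
    ((Real.measurable_exp.comp_aemeasurable ((hf.aestronglyMeasurable.sub
      aestronglyMeasurable_const).norm.aemeasurable.const_mul a))).ennreal_ofReal
  rw [lintegral_eq_iSup_min (hmeas _).restrict fun x => ENNReal.ofReal_ne_top]
  refine iSup_le fun M => ?_
  let g : E → ℝ≥0∞ := fun v => min (G v) M
  -- The best constant for the truncated exponential over all admissible balls. Truncation at `M`
  -- makes it finite, so that it can be absorbed in `S ≤ 3/2 + (3/4) S`, which gives `S ≤ 6`
  -- independently of `M`.
  let S : ℝ≥0∞ := ⨆ (x : V) (t : ℝ) (_ : 0 < t) (_ : ball x (2 * t) ⊆ U),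
    (∫⁻ z in ball x t, g (f z - ⨍ w in ball x t, f w ∂μ) ∂μ) / μ (ball x t)
  have hle : ∀ (x : V) (t : ℝ), 0 < t → ball x (2 * t) ⊆ U →
      ∫⁻ z in ball x t, g (f z - ⨍ w in ball x t, f w ∂μ) ∂μ ≤ S * μ (ball x t) := by
    intro x t ht hx
    rw [← ENNReal.div_le_iff (measure_ball_pos μ x ht).ne' measure_ball_lt_top.ne]
    exact le_iSup_of_le x (le_iSup_of_le t (le_iSup_of_le ht (le_iSup_of_le hx le_rfl)))
  have hSM : S ≤ M := by
    refine iSup_le fun x => iSup_le fun t => iSup_le fun ht => iSup_le fun hx => ?_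
    rw [ENNReal.div_le_iff (measure_ball_pos μ x ht).ne' measure_ball_lt_top.ne,
      ← setLIntegral_const]
    exact lintegral_mono fun z => min_le_right _ _
  have hstep : S ≤ ((3 / 2 : ℝ≥0) : ℝ≥0∞) + ((3 / 2 : ℝ≥0) : ℝ≥0∞) * (2⁻¹ * S) := by
    refine iSup_le fun x => iSup_le fun t => iSup_le fun ht => iSup_le fun hx => ?_
    rw [ENNReal.div_le_iff (measure_ball_pos μ x ht).ne' measure_ball_lt_top.ne]
    obtain ⟨u, ρ, hu, hρ, hsum, hae⟩ := h.exists_stopping_balls μ hf ht hx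
    set m := ⨍ w in ball x t, f w ∂μ with hm
    have : Countable u := hu.to_subtype
    set W : Set V := ⋃ y ∈ u, ball y (ρ y) with hW
    have hWm : MeasurableSet W := (isOpen_biUnion fun _ _ => isOpen_ball).measurableSet
    have hpt : ∀ᵐ z ∂μ, z ∈ ball x t →
        g (f z - m) ≤ ((3 / 2 : ℝ≥0) : ℝ≥0∞) + W.indicator (fun z => g (f z - m)) z := by
      filter_upwards [hae] with z hz hzB
      rcases hz hzB with hz | hz
      · rw [Set.indicator_of_mem hz]; exact le_add_self
      · refine le_trans ?_ le_self_add
        have := hGadd M 0 (f z - m) hz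
        rw [zero_add] at this
        refine this.trans (mul_le_of_le_one_right' ((min_le_left _ _).trans ?_))
        simp [G]
    have hWle : ∫⁻ z in W, g (f z - m) ∂μ
        ≤ ((3 / 2 : ℝ≥0) : ℝ≥0∞) * (S * (2⁻¹ * μ (ball x t))) := by
      rw [hW, Set.biUnion_eq_iUnion]
      calc _ ≤ ∑' y : u, ∫⁻ z in ball (y : V) (ρ y), g (f z - m) ∂μ := lintegral_iUnion_le _ _
        _ ≤ ∑' y : u, ((3 / 2 : ℝ≥0) : ℝ≥0∞) * (S * μ (ball (y : V) (ρ y))) := by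
            refine ENNReal.tsum_le_tsum fun y => ?_
            obtain ⟨h1, h2, h3⟩ := hρ y y.2
            refine le_trans ?_ (mul_le_mul_right (hle y (ρ y) h1 h2) _)
            rw [← lintegral_const_mul' _ _ ENNReal.coe_ne_top]
            refine lintegral_mono fun z => ?_
            have := hGadd M (f z - ⨍ w in ball (y : V) (ρ y), f w ∂μ) _ h3
            rwa [sub_add_sub_cancel] at this
        _ ≤ _ := by
            rw [ENNReal.tsum_mul_left, ENNReal.tsum_mul_left]
            gcongr
    calc ∫⁻ z in ball x t, g (f z - m) ∂μ
        ≤ ∫⁻ z in ball x t, (((3 / 2 : ℝ≥0) : ℝ≥0∞) +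
            W.indicator (fun z => g (f z - m)) z) ∂μ :=
          setLIntegral_mono_ae' measurableSet_ball hpt
      _ = ((3 / 2 : ℝ≥0) : ℝ≥0∞) * μ (ball x t) +
            ∫⁻ z in ball x t, W.indicator (fun z => g (f z - m)) z ∂μ := by
          rw [lintegral_add_left measurable_const, setLIntegral_const]
      _ ≤ ((3 / 2 : ℝ≥0) : ℝ≥0∞) * μ (ball x t) + ∫⁻ z in W, g (f z - m) ∂μ := by
          rw [← lintegral_indicator hWm]
          gcongr
          exact Measure.restrict_le_self
      _ ≤ ((3 / 2 : ℝ≥0) : ℝ≥0∞) * μ (ball x t) +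
            ((3 / 2 : ℝ≥0) : ℝ≥0∞) * (S * (2⁻¹ * μ (ball x t))) := by gcongr
      _ = _ := by ring
  have hS6 : S ≤ 6 := by
    have hS : S ≠ ∞ := (hSM.trans_lt (ENNReal.natCast_lt_top M)).ne
    generalize S = S' at hstep hS
    lift S' to ℝ≥0 using hS
    have h2 : (2⁻¹ : ℝ≥0∞) = ((2⁻¹ : ℝ≥0) : ℝ≥0∞) := by simp
    rw [h2] at hstep
    have h3 : S' ≤ 3 / 2 + 3 / 2 * (2⁻¹ * S') := by exact_mod_cast hstep
    have h4 : (S' : ℝ) ≤ 3 / 2 + 3 / 2 * (2⁻¹ * S') := by exact_mod_cast h3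
    have h5 : (S' : ℝ) ≤ 6 := by linarith
    exact_mod_cast h5
  exact (hle x₀ s hs hU).trans (by gcongr)

/-! ### Whitney averaging: from interior balls to the full ball. -/

/-- Averaging over Whitney balls dominates the integral over a ball. -/
lemma setLIntegral_ball_le_whitney {g : V → ℝ≥0∞} (hg : AEMeasurable g μ) (y : V) (r : ℝ) :
    ∫⁻ z in ball y r, g z ∂μ ≤ 4 ^ finrank ℝ V * ∫⁻ x in ball y r,
      (∫⁻ z in ball x ((r - dist x y) / 2), g z ∂μ) / μ (ball x ((r - dist x y) / 2)) ∂μ := by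
  wlog hgm : Measurable g generalizing g
  · have := this hg.measurable_mk.aemeasurable hg.measurable_mk
    simpa only [lintegral_congr_ae (ae_restrict_of_ae hg.ae_eq_mk)]
      using this
  set D := finrank ℝ V with hD
  let d : V → ℝ := fun x => r - dist x y
  have hd : Continuous d := by fun_prop
  let w : V → ℝ≥0∞ := fun x => (ENNReal.ofReal ((d x / 2) ^ D) * μ (ball 0 1))⁻¹
  -- On the ball, `w x` is the inverse measure of the Whitney ball at `x`; the explicit power of `d
  -- x / 2` makes measurability visible.
  have hw : Measurable w := by fun_prop
  let T : Set (V × V) := {p | p.1 ∈ ball y r ∧ dist p.2 p.1 < d p.1 / 2}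
  have hT : MeasurableSet T := by
    have h1 : IsOpen {p : V × V | dist p.2 p.1 < d p.1 / 2} :=
      isOpen_lt (by fun_prop) (by fun_prop)
    exact ((isOpen_ball.preimage continuous_fst).inter h1).measurableSet
  let K : V → V → ℝ≥0∞ := fun x z => T.indicator (fun p => g p.2 * w p.1) (x, z)
  have hK : Measurable (Function.uncurry K) :=
    ((hgm.comp measurable_snd).mul (hw.comp measurable_fst)).indicator hT
  have hinner : ∀ x ∈ ball y r, ∫⁻ z, K x z ∂μ
      = (∫⁻ z in ball x (d x / 2), g z ∂μ) / μ (ball x (d x / 2)) := by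
    intro x hx
    have hdx : 0 < d x / 2 := by
      have := mem_ball.1 hx
      simp only [d]; linarith
    rw [div_eq_mul_inv, Measure.addHaar_ball_of_pos μ x hdx, ← lintegral_mul_const _ hgm,
      ← lintegral_indicator measurableSet_ball]
    refine lintegral_congr fun z => ?_
    by_cases hz : z ∈ ball x (d x / 2)
    · rw [Set.indicator_of_mem hz]
      exact Set.indicator_of_mem (s := T) (show (x, z) ∈ T from ⟨hx, hz⟩) _
    · rw [Set.indicator_of_notMem hz]
      exact Set.indicator_of_notMem (s := T) (fun h : (x, z) ∈ T => hz h.2) _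
  have hlower : ∀ z ∈ ball y r, g z ≤ 4 ^ D * ∫⁻ x, K x z ∂μ := by
    intro z hz
    have hdz : 0 < d z := by
      have := mem_ball.1 hz
      simp only [d]; linarith
    -- For such `x`, `d x` lies between `3/4` and `5/4` of `d z`: the Whitney ball at `x` contains
    -- `z` and is no larger than the ball of radius `d z`.
    have h1 : ∀ x ∈ ball z (d z / 4), g z * (μ (ball z (d z)))⁻¹ ≤ K x z := by
      intro x hx
      have hxz := mem_ball.1 hx
      have t1 := dist_triangle x z y
      have t2 := dist_triangle z x y
      rw [dist_comm z x] at t2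
      have hmem : (x, z) ∈ T := by
        refine ⟨mem_ball.2 ?_, ?_⟩ <;> simp only [d, dist_comm z x] at * <;> linarith
      have hdx : d x / 2 ≤ d z := by simp only [d] at *; linarith
      have hdx0 : 0 ≤ d x / 2 := by simp only [d] at *; linarith
      simp only [K, Set.indicator_of_mem hmem, w]
      rw [Measure.addHaar_ball_of_pos μ z hdz]
      gcongr
    have h2 : g z * (μ (ball z (d z)))⁻¹ * μ (ball z (d z / 4)) ≤ ∫⁻ x, K x z ∂μ := by
      rw [← setLIntegral_const]
      exact (setLIntegral_mono' measurableSet_ball h1).trans (setLIntegral_le_lintegral _ _)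
    have h3 : μ (ball z (d z)) = 4 ^ D * μ (ball z (d z / 4)) := by
      have := measure_ball_natCast_mul μ z z (c := 4) (by norm_num) (d z / 4)
      push_cast at this
      rwa [mul_div_cancel₀ _ (by norm_num : (4 : ℝ) ≠ 0)] at this
    calc g z = g z * ((μ (ball z (d z)))⁻¹ * μ (ball z (d z))) := by
          rw [ENNReal.inv_mul_cancel (measure_ball_pos μ z hdz).ne' measure_ball_lt_top.ne, mul_one]
      _ = 4 ^ D * (g z * (μ (ball z (d z)))⁻¹ * μ (ball z (d z / 4))) := by
          nth_rewrite 2 [h3]; ring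
      _ ≤ _ := by gcongr
  calc ∫⁻ z in ball y r, g z ∂μ ≤ ∫⁻ z in ball y r, 4 ^ D * ∫⁻ x, K x z ∂μ ∂μ :=
        setLIntegral_mono' measurableSet_ball hlower
    _ ≤ ∫⁻ z, 4 ^ D * ∫⁻ x, K x z ∂μ ∂μ := setLIntegral_le_lintegral _ _
    _ = 4 ^ D * ∫⁻ x, ∫⁻ z, K x z ∂μ ∂μ := by
        rw [lintegral_const_mul' _ _ (ENNReal.pow_ne_top (by norm_num)),
          lintegral_lintegral_swap hK.aemeasurable]
    _ = 4 ^ D * ∫⁻ x in ball y r, ∫⁻ z, K x z ∂μ ∂μ := by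
        congr 1
        rw [← lintegral_indicator measurableSet_ball]
        refine lintegral_congr fun x => ?_
        by_cases hx : x ∈ ball y r
        · rw [Set.indicator_of_mem hx]
        · rw [Set.indicator_of_notMem hx]
          have : ∀ z, K x z = 0 := fun z => Set.indicator_of_notMem (fun h => hx h.1) _
          simp [this]
    _ = _ := by rw [setLIntegral_congr_fun measurableSet_ball hinner]

/-- The inverse square root of the distance to the boundary of a ball is integrable on the ball,
with the natural scaling. -/
lemma exists_setLIntegral_sqrt_inv_dist_boundary_le [Nontrivial V] :
    ∃ C : ℝ≥0, ∀ (y : V) (r : ℝ), 0 < r →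
      ∫⁻ x in ball y r, ENNReal.ofReal √(r / (r - dist x y)) ∂μ ≤ C * μ (ball y r) := by
  have hpos : μ (ball (0 : V) 1) ≠ 0 := (measure_ball_pos μ 0 one_pos).ne'
  have htop : μ (ball (0 : V) 1) ≠ ∞ := measure_ball_lt_top.ne
  set I : ℝ≥0∞ := ∫⁻ x in ball (0 : V) 1, ENNReal.ofReal √(1 / (1 - ‖x‖)) ∂μ with hI
  have hIfin : I ≠ ∞ := by
    have h1 : IntegrableOn (fun t : ℝ => (1 - t) ^ (-1 / 2 : ℝ)) (Set.Ioo 0 1) := by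
      have := (intervalIntegral.intervalIntegrable_rpow' (a := 0) (b := 1)
        (by norm_num : (-1 : ℝ) < -1 / 2)).comp_sub_left 1
      simp only [sub_zero, sub_self] at this
      exact ((intervalIntegrable_iff_integrableOn_Ioo_of_le zero_le_one).1 this.symm)
    have h2 : IntegrableOn (fun x : V => √(1 / (1 - ‖x‖))) (ball 0 1) μ := by
      -- Polar coordinates: the radial density is at most `1` on `(0, 1)`, leaving the integrable
      -- power `(1 - t) ^ (-1/2)`.
      refine (integrableOn_fun_norm_addHaar μ (f := fun t => √(1 / (1 - t)))).2 ?_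
      refine Integrable.mono' h1 (by fun_prop) ?_
      filter_upwards [ae_restrict_mem measurableSet_Ioo] with t ht
      have ht1 : 0 < 1 - t := by linarith [ht.2]
      rw [norm_smul, Real.norm_of_nonneg (Real.sqrt_nonneg _), norm_pow,
        Real.norm_of_nonneg ht.1.le, Real.sqrt_eq_rpow, one_div,
        ← Real.rpow_neg_one, ← Real.rpow_mul ht1.le,
        show (-1 : ℝ) * (1 / 2) = -1 / 2 by norm_num]
      exact mul_le_of_le_one_left (by positivity) (pow_le_one₀ ht.1.le ht.2.le)
    have h3 := h2.hasFiniteIntegral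
    rw [hasFiniteIntegral_iff_ofReal (Filter.Eventually.of_forall fun _ => Real.sqrt_nonneg _)] at h3
    exact h3.ne
  refine ⟨(I / μ (ball 0 1)).toNNReal, fun y r hr => ?_⟩
  rw [ENNReal.coe_toNNReal (ENNReal.div_ne_top hIfin hpos)]
  have hF : Measurable ((ball y r).indicator
      fun x => ENNReal.ofReal √(r / (r - dist x y))) :=
    Measurable.indicator (by fun_prop) measurableSet_ball
  have hscale : I = ENNReal.ofReal |(r ^ finrank ℝ V)⁻¹| *
      ∫⁻ x in ball y r, ENNReal.ofReal √(r / (r - dist x y)) ∂μ := by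
    rw [← lintegral_indicator measurableSet_ball, ← lintegral_add_left_eq_self _ y, ← smul_eq_mul,
      ← lintegral_smul_measure, ← Measure.map_addHaar_smul μ hr.ne',
      lintegral_map (f := fun x => (ball y r).indicator
        (fun x => ENNReal.ofReal √(r / (r - dist x y))) (y + x))
        (hF.comp (measurable_const_add y)) (measurable_const_smul r), hI,
      ← lintegral_indicator measurableSet_ball]
    refine lintegral_congr fun x => ?_
    have h1 : dist (y + r • x) y = r * ‖x‖ := by
      rw [dist_eq_norm, add_sub_cancel_left, norm_smul, Real.norm_of_nonneg hr.le]
    have h2 : y + r • x ∈ ball y r ↔ x ∈ ball (0 : V) 1 := by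
      rw [mem_ball, h1, mem_ball_zero_iff]
      exact mul_lt_iff_lt_one_right hr
    by_cases hx : x ∈ ball (0 : V) 1
    · rw [Set.indicator_of_mem hx, Set.indicator_of_mem (h2.2 hx), h1]
      congr 2
      rw [show r - r * ‖x‖ = r * (1 - ‖x‖) by ring, ← div_div, div_self hr.ne']
    · rw [Set.indicator_of_notMem hx, Set.indicator_of_notMem fun h => hx (h2.1 h)]
  have hrD : 0 < r ^ finrank ℝ V := by positivity
  rw [Measure.addHaar_ball_of_pos μ y hr, mul_comm (ENNReal.ofReal _), ← mul_assoc,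
    ENNReal.div_mul_cancel hpos htop, hscale, abs_of_pos (inv_pos.2 hrD), mul_right_comm,
    ← ENNReal.ofReal_mul (inv_pos.2 hrD).le, inv_mul_cancel₀ hrD.ne', ENNReal.ofReal_one, one_mul]

/-- The mean over the Whitney ball centred at `x` differs from the mean over the ambient ball by a
logarithm of the relative distance to the boundary. -/
lemma OscLeOne.exp_norm_whitney_sub_le {f : V → E} {y : V} {r : ℝ} (hf : LocallyIntegrable f μ)
    (hr : 0 < r) (h : OscLeOne μ f (ball y r)) {x : V} (hx : x ∈ ball y r) :
    Real.exp (jnExponent (finrank ℝ V) *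
        ‖(⨍ z in ball x ((r - dist x y) / 2), f z ∂μ) - ⨍ z in ball y r, f z ∂μ‖)
      ≤ 2 * √(8 * (r / (r - dist x y))) := by
  set D := finrank ℝ V with hD
  set d := r - dist x y with hd
  have hxy := mem_ball.1 hx
  have hd0 : 0 < d := by simp only [hd]; linarith
  have hdr : d ≤ r := by simp only [hd]; linarith [dist_nonneg (x := x) (y := y)]
  obtain ⟨N, hN1, hN2⟩ := exists_nat_pow_near (x := 4 * r / d) (y := (2 : ℝ))
    ((one_le_div hd0).2 (by linarith)) one_lt_two
  rw [le_div_iff₀ hd0] at hN1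
  rw [div_lt_iff₀ hd0] at hN2
  -- A nested chain of balls, halving in radius, whose centres move from `y` towards `x`. After `N +
  -- 1` steps, with `2 ^ N` comparable to `r / d`, the ball lies in the Whitney ball; each step
  -- changes the mean by at most `2 ^ D`.
  let c : ℕ → V := fun j => x + (1 / 2 : ℝ) ^ j • (y - x)
  have hchain : ∀ j : ℕ, ball (c (j + 1)) (r * (1 / 2) ^ (j + 1)) ⊆ ball (c j) (r * (1 / 2) ^ j) := by
    intro j
    apply ball_subset_ball'
    have : c (j + 1) - c j = -((1 / 2 : ℝ) ^ (j + 1)) • (y - x) := by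
      simp only [c, pow_succ]; module
    rw [dist_eq_norm, this, norm_smul, norm_neg, Real.norm_of_nonneg (by positivity),
      ← dist_eq_norm, dist_comm]
    have : (1 / 2 : ℝ) ^ (j + 1) * dist x y ≤ (1 / 2) ^ (j + 1) * r := by gcongr
    rw [pow_succ] at *
    linarith
  have hc0 : c 0 = y := by simp [c]
  have hsub : ∀ j : ℕ, ball (c j) (r * (1 / 2) ^ j) ⊆ ball y r := by
    intro j
    induction j with
    | zero => simp [hc0]
    | succ j ih => exact (hchain j).trans ih
  have hmeans : ∀ j : ℕ, ‖(⨍ z in ball (c j) (r * (1 / 2) ^ j), f z ∂μ) - ⨍ z in ball y r, f z ∂μ‖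
      ≤ j * 2 ^ D := by
    intro j
    induction j with
    | zero => simp [hc0]
    | succ j ih =>
      have h1 := h.norm_setAverage_sub_le μ hf (by positivity) (by positivity) (hchain j) (hsub j)
        two_ne_zero (by rw [pow_succ]; push_cast; linarith)
      refine (norm_sub_le_norm_sub_add_norm_sub _ _ _).trans ((add_le_add h1 ih).trans ?_)
      push_cast
      linarith
  have hpow : (1 / 2 : ℝ) ^ (N + 1) * 2 ^ (N + 1) = 1 := by rw [← mul_pow]; norm_num
  have hpN : (1 / 2 : ℝ) ^ N * 2 ^ N = 1 := by rw [← mul_pow]; norm_num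
  have hsmall : r * (1 / 2) ^ (N + 1) < d / 4 := by
    have h1 : (0 : ℝ) < (1 / 2) ^ (N + 1) := by positivity
    have := mul_lt_mul_of_pos_left hN2 h1
    rw [← mul_assoc _ _ d, hpow] at this
    linarith
  have hlarge : d ≤ 8 * (r * (1 / 2) ^ (N + 1)) := by
    have h1 : (0 : ℝ) < (1 / 2) ^ N := by positivity
    have := mul_le_mul_of_nonneg_left hN1 h1.le
    rw [← mul_assoc _ _ d, hpN] at this
    rw [pow_succ]
    linarith
  have hW : ball (c (N + 1)) (r * (1 / 2) ^ (N + 1)) ⊆ ball x (d / 2) := by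
    apply ball_subset_ball'
    have : c (N + 1) - x = ((1 / 2 : ℝ) ^ (N + 1)) • (y - x) := by simp [c]
    rw [dist_eq_norm, this, norm_smul, Real.norm_of_nonneg (by positivity), ← dist_eq_norm,
      dist_comm]
    have : (1 / 2 : ℝ) ^ (N + 1) * dist x y ≤ (1 / 2) ^ (N + 1) * r := by gcongr
    linarith
  have hWU : ball x (d / 2) ⊆ ball y r := ball_subset_ball' (by simp only [hd] at *; linarith)
  have h4 := h.norm_setAverage_sub_le μ hf (by positivity) (by positivity) hW hWU
    (c := 4) (by norm_num) (by push_cast; linarith)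
  rw [norm_sub_rev] at h4
  have htotal := (norm_sub_le_norm_sub_add_norm_sub _ _ _).trans (add_le_add h4 (hmeans (N + 1)))
  set a := jnExponent D with ha
  have ha0 : 0 < a := jnExponent_pos D
  have h32 : (0 : ℝ) < 32 ^ D := by positivity
  have e1 : Real.exp (a * 4 ^ D) ≤ 2 := by
    calc Real.exp (a * 4 ^ D) ≤ Real.exp (a * (4 * 32 ^ D)) := by
          gcongr
          have : (4 : ℝ) ^ D ≤ 32 ^ D := by gcongr; norm_num
          linarith
      _ = 3 / 2 := exp_jnExponent_mul D
      _ ≤ 2 := by norm_num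
  -- Each link costs at most a factor `√2`, so the whole chain costs `√(2 ^ (N + 1))`: this is where
  -- the square root of `r / d` comes from.
  have e2 : Real.exp (a * 2 ^ D) ^ 2 ≤ 2 := by
    rw [← Real.exp_nat_mul]
    calc Real.exp ((2 : ℕ) * (a * 2 ^ D)) ≤ Real.exp (a * (4 * 32 ^ D)) := by
          rw [Real.exp_le_exp]
          have : (2 : ℝ) ^ D ≤ 32 ^ D := by gcongr; norm_num
          push_cast
          nlinarith
      _ = 3 / 2 := exp_jnExponent_mul D
      _ ≤ 2 := by norm_num
  have e3 : Real.exp (a * 2 ^ D) ^ (N + 1) ≤ √(8 * (r / d)) := by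
    apply Real.le_sqrt_of_sq_le
    rw [← pow_mul, mul_comm (N + 1), pow_mul]
    calc (Real.exp (a * 2 ^ D) ^ 2) ^ (N + 1) ≤ 2 ^ (N + 1) := by gcongr
      _ ≤ 8 * (r / d) := by
          rw [← mul_div_assoc, le_div_iff₀ hd0, pow_succ]
          linarith
  calc _ ≤ Real.exp (a * 4 ^ D + (N + 1 : ℕ) * (a * 2 ^ D)) := by
        rw [Real.exp_le_exp]
        refine (mul_le_mul_of_nonneg_left htotal ha0.le).trans_eq ?_
        push_cast
        ring
    _ = Real.exp (a * 4 ^ D) * Real.exp (a * 2 ^ D) ^ (N + 1) := by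
        rw [Real.exp_add, Real.exp_nat_mul]
    _ ≤ _ := by gcongr

/-- The **John–Nirenberg inequality** on a ball `B`, in terms of the mean oscillations over the
balls contained in `B` only. -/
theorem exists_lintegral_exp_le_of_oscLeOne [Nontrivial V] :
    ∃ C : ℝ≥0, ∀ (f : V → E), LocallyIntegrable f μ → ∀ (y : V) (r : ℝ), 0 < r →
      OscLeOne μ f (ball y r) →
      ∫⁻ x in ball y r, ENNReal.ofReal (Real.exp (jnExponent (finrank ℝ V) *
        ‖f x - ⨍ z in ball y r, f z ∂μ‖)) ∂μ ≤ C * μ (ball y r) := by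
  obtain ⟨C, hC⟩ := exists_setLIntegral_sqrt_inv_dist_boundary_le μ
  refine ⟨4 ^ finrank ℝ V * (36 * C), fun f hf y r hr h => ?_⟩
  set a := jnExponent (finrank ℝ V) with ha
  have ha0 : 0 < a := jnExponent_pos _
  set m := ⨍ z in ball y r, f z ∂μ with hm
  have hmeas : AEMeasurable (fun x => ENNReal.ofReal (Real.exp (a * ‖f x - m‖))) μ :=
    (Real.measurable_exp.comp_aemeasurable ((hf.aestronglyMeasurable.sub
      aestronglyMeasurable_const).norm.aemeasurable.const_mul a)).ennreal_ofReal
  refine (setLIntegral_ball_le_whitney μ hmeas y r).trans ?_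
  have hpt : ∀ x ∈ ball y r,
      (∫⁻ z in ball x ((r - dist x y) / 2), ENNReal.ofReal (Real.exp (a * ‖f z - m‖)) ∂μ) /
        μ (ball x ((r - dist x y) / 2)) ≤ 36 * ENNReal.ofReal √(r / (r - dist x y)) := by
    intro x hx
    have hxy := mem_ball.1 hx
    set d := r - dist x y with hd
    have hd0 : 0 < d := by simp only [hd]; linarith
    rw [ENNReal.div_le_iff (measure_ball_pos μ x (half_pos hd0)).ne' measure_ball_lt_top.ne]
    have hadm : ball x (2 * (d / 2)) ⊆ ball y r :=
      ball_subset_ball' (by simp only [hd]; linarith)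
    have h1 := h.lintegral_exp_le_of_double_subset μ hf (half_pos hd0) hadm
    have h2 := h.exp_norm_whitney_sub_le μ hf hr hx
    set m' := ⨍ z in ball x (d / 2), f z ∂μ with hm'
    have h3 : Real.exp (a * ‖m' - m‖) ≤ 6 * √(r / d) := by
      refine h2.trans ?_
      rw [Real.sqrt_mul (by norm_num), ← mul_assoc]
      gcongr
      nlinarith [Real.sq_sqrt (show (0 : ℝ) ≤ 8 by norm_num), Real.sqrt_nonneg (8 : ℝ)]
    calc ∫⁻ z in ball x (d / 2), ENNReal.ofReal (Real.exp (a * ‖f z - m‖)) ∂μ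
        ≤ ∫⁻ z in ball x (d / 2), ENNReal.ofReal (6 * √(r / d)) *
            ENNReal.ofReal (Real.exp (a * ‖f z - m'‖)) ∂μ := by
          refine lintegral_mono fun z => ?_
          rw [← ENNReal.ofReal_mul (by positivity)]
          apply ENNReal.ofReal_le_ofReal
          refine le_trans ?_ (mul_le_mul_of_nonneg_right h3 (Real.exp_pos _).le)
          rw [← Real.exp_add, Real.exp_le_exp, ← mul_add]
          gcongr
          rw [add_comm]
          exact norm_sub_le_norm_sub_add_norm_sub _ _ _
      _ = ENNReal.ofReal (6 * √(r / d)) *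
            ∫⁻ z in ball x (d / 2), ENNReal.ofReal (Real.exp (a * ‖f z - m'‖)) ∂μ :=
          lintegral_const_mul' _ _ ENNReal.ofReal_ne_top
      _ ≤ ENNReal.ofReal (6 * √(r / d)) * (6 * μ (ball x (d / 2))) := by gcongr
      _ = _ := by
          rw [ENNReal.ofReal_mul (by norm_num)]
          simp only [ENNReal.ofReal_ofNat]
          ring
  calc _ ≤ 4 ^ finrank ℝ V * ∫⁻ x in ball y r, 36 * ENNReal.ofReal √(r / (r - dist x y)) ∂μ := by
        exact mul_le_mul_right (setLIntegral_mono' measurableSet_ball hpt) _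
    _ ≤ 4 ^ finrank ℝ V * (36 * (C * μ (ball y r))) := by
        rw [lintegral_const_mul' _ _ (by norm_num)]
        gcongr
        exact hC y r hr
    _ = _ := by push_cast; ring

/-- The John–Nirenberg inequality for functions of mean oscillation at most `N`. -/
theorem exists_lintegral_exp_div_le [Nontrivial V] :
    ∃ C : ℝ≥0, ∀ (f : V → E), LocallyIntegrable f μ → ∀ (y : V) (r N : ℝ), 0 < r → 0 < N →
      (∀ (x : V) (s : ℝ), 0 < s → ball x s ⊆ ball y r →
        ∫⁻ z in ball x s, ‖f z - ⨍ w in ball x s, f w ∂μ‖ₑ ∂μ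
          ≤ ENNReal.ofReal N * μ (ball x s)) →
      ∫⁻ x in ball y r, ENNReal.ofReal (Real.exp (jnExponent (finrank ℝ V) *
        (‖f x - ⨍ z in ball y r, f z ∂μ‖ / N))) ∂μ ≤ C * μ (ball y r) := by
  obtain ⟨C, hC⟩ := exists_lintegral_exp_le_of_oscLeOne (E := E) μ
  refine ⟨C, fun f hf y r N hr hN h => ?_⟩
  have hsub : ∀ (x : V) (s : ℝ) (z : V), (N⁻¹ • f) z - ⨍ w in ball x s, (N⁻¹ • f) w ∂μ
      = N⁻¹ • (f z - ⨍ w in ball x s, f w ∂μ) := by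
    intro x s z
    simp only [Pi.smul_apply, average, integral_smul, smul_sub]
  have hNe : ‖(N⁻¹ : ℝ)‖ₑ * ENNReal.ofReal N = 1 := by
    rw [Real.enorm_of_nonneg (inv_pos.2 hN).le, ← ENNReal.ofReal_mul (inv_pos.2 hN).le,
      inv_mul_cancel₀ hN.ne', ENNReal.ofReal_one]
  have := hC (N⁻¹ • f) (hf.smul N⁻¹) y r hr (fun x s hs hx => by
    simp only [hsub, enorm_smul]
    rw [lintegral_const_mul' _ _ enorm_ne_top]
    calc _ ≤ ‖(N⁻¹ : ℝ)‖ₑ * (ENNReal.ofReal N * μ (ball x s)) := by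
          gcongr
          exact h x s hs hx
      _ = μ (ball x s) := by rw [← mul_assoc, hNe, one_mul])
  simp only [hsub, norm_smul, norm_inv, Real.norm_of_nonneg hN.le] at this
  simpa only [div_eq_inv_mul] using this

end JohnNirenberg

/-! ### Weighted oscillation of a matrix weight from the oscillation of its logarithm. -/

section MatrixWeights

open scoped NNReal

variable {n : ℕ}

lemma logWeight_isSelfAdjoint (A : EuclideanSpace ℝ (Fin n) → Matrix (Fin n) (Fin n) ℝ)
    (x : EuclideanSpace ℝ (Fin n)) : IsSelfAdjoint (logWeight A x) :=
  IsSelfAdjoint.log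

open scoped MatrixOrder in
lemma exp_logWeight {A : EuclideanSpace ℝ (Fin n) → Matrix (Fin n) (Fin n) ℝ}
    {x : EuclideanSpace ℝ (Fin n)} (hx : (A x).PosDef) :
    NormedSpace.exp (logWeight A x) = A x :=
  CFC.exp_log (A x) (Matrix.isStrictlyPositive_iff_posDef.2 hx)

/-- The adjoint is continuous and linear, hence commutes with the integral. This makes the
exponential estimates applicable to the mean of `log A`. -/
lemma IsSelfAdjoint.setAverage {H : EuclideanSpace ℝ (Fin n) → Matrix (Fin n) (Fin n) ℝ}
    (hH : ∀ x, IsSelfAdjoint (H x)) (S : Set (EuclideanSpace ℝ (Fin n))) :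
    IsSelfAdjoint (⨍ x in S, H x) := by
  have h := (starL' ℝ : Matrix (Fin n) (Fin n) ℝ ≃L[ℝ] Matrix (Fin n) (Fin n) ℝ).integral_comp_comm
    (μ := ((volume.restrict S) Set.univ)⁻¹ • volume.restrict S) H
  simp only [starL'_apply] at h
  simp only [IsSelfAdjoint, average]
  rw [← h]
  exact integral_congr_ae (Filter.Eventually.of_forall fun x => hH x)

open scoped MatrixOrder in
lemma Matrix.norm_exp_le_exp_norm_sub_mul [NeZero n] {a b : Matrix (Fin n) (Fin n) ℝ}
    (ha : IsSelfAdjoint a) (hb : IsSelfAdjoint b) :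
    ‖NormedSpace.exp a‖ ≤ Real.exp ‖a - b‖ * ‖NormedSpace.exp b‖ :=
  norm_exp_le ha hb

open scoped MatrixOrder in
lemma Matrix.norm_exp_sub_exp_le [NeZero n] {a b : Matrix (Fin n) (Fin n) ℝ}
    (ha : IsSelfAdjoint a) (hb : IsSelfAdjoint b) :
    ‖NormedSpace.exp a - NormedSpace.exp b‖
      ≤ ‖a - b‖ * Real.exp ‖a - b‖ * ‖NormedSpace.exp b‖ :=
  _root_.norm_exp_sub_exp_le ha hb

open scoped MatrixOrder in
lemma Matrix.norm_exp_pos [NeZero n] {a : Matrix (Fin n) (Fin n) ℝ} (ha : IsSelfAdjoint a) :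
    0 < ‖NormedSpace.exp a‖ := by
  obtain ⟨M, hM, -⟩ := exists_norm_exp_smul_eq ha
  have := hM 1 zero_le_one
  rw [one_smul] at this
  rw [this]
  exact Real.exp_pos _

lemma setLIntegral_le_of_bmoSeminorm_le {f : EuclideanSpace ℝ (Fin n) → Matrix (Fin n) (Fin n) ℝ}
    {U : Set (EuclideanSpace ℝ (Fin n))} {N : ℝ≥0∞} (h : bmoSeminorm f U ≤ N)
    {x : EuclideanSpace ℝ (Fin n)} {s : ℝ} (hs : 0 < s) (hx : ball x s ⊆ U) :
    ∫⁻ z in ball x s, ‖f z - ⨍ w in ball x s, f w‖ₑ ≤ N * volume (ball x s) := by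
  rw [← ENNReal.div_le_iff (measure_ball_pos volume x hs).ne' measure_ball_lt_top.ne,
    ← setLAverage_eq]
  simp only [bmoSeminorm, iSup_le_iff] at h
  exact h x s hs hx

lemma bmoSeminorm_mono (f : EuclideanSpace ℝ (Fin n) → Matrix (Fin n) (Fin n) ℝ)
    {U W : Set (EuclideanSpace ℝ (Fin n))} (h : U ⊆ W) : bmoSeminorm f U ≤ bmoSeminorm f W :=
  iSup_mono fun _ => iSup_mono fun _ => iSup_mono fun _ =>
    iSup_le fun hx => le_iSup_of_le (hx.trans h) le_rfl

/-- Elementary bounds for `u` in terms of `exp (a u / N)`. -/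
lemma mul_exp_bounds {a N u : ℝ} (ha : 0 < a) (hN : 0 < N) (hNa : N ≤ a / 6) (hu : 0 ≤ u) :
    Real.exp u ≤ Real.exp (a * (u / N)) ∧
    u * Real.exp u ≤ 2 * N / a * Real.exp (a * (u / N)) ∧
    u ^ 2 * Real.exp (3 * u) ≤ 8 * N ^ 2 / a ^ 2 * Real.exp (a * (u / N)) := by
  set t := a * (u / N) with ht
  have ht0 : 0 ≤ t := by positivity
  have hut : u = N / a * t := by rw [ht]; field_simp
  -- The smallness `N ≤ a / 6` leaves room for `exp (3 * u) ≤ exp (t / 2)`; the other half of the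
  -- exponent absorbs the power of `t`.
  have h6 : 6 * u ≤ t := by
    have : N / a ≤ 1 / 6 := by rw [div_le_iff₀ ha]; linarith
    rw [hut]; nlinarith
  have hexp : ∀ v : ℝ, v ≤ t → Real.exp v ≤ Real.exp t := fun v hv => Real.exp_le_exp.2 hv
  have hhalf : Real.exp (t / 2) * Real.exp (t / 2) = Real.exp t := by
    rw [← Real.exp_add, add_halves]
  have hq := Real.quadratic_le_exp_of_nonneg (div_nonneg ht0 zero_le_two)
  refine ⟨hexp u (by linarith), ?_, ?_⟩
  · have h1 : Real.exp u ≤ Real.exp (t / 2) := Real.exp_le_exp.2 (by linarith)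
    have h2 : t ≤ 2 * Real.exp (t / 2) := by nlinarith [sq_nonneg t]
    calc u * Real.exp u = N / a * (t * Real.exp u) := by rw [← mul_assoc, ← hut]
      _ ≤ N / a * (2 * Real.exp (t / 2) * Real.exp (t / 2)) := by gcongr
      _ = _ := by rw [mul_assoc 2, hhalf]; ring
  · have h1 : Real.exp (3 * u) ≤ Real.exp (t / 2) := Real.exp_le_exp.2 (by linarith)
    have h2 : t ^ 2 ≤ 8 * Real.exp (t / 2) := by nlinarith
    calc u ^ 2 * Real.exp (3 * u) = (N / a) ^ 2 * (t ^ 2 * Real.exp (3 * u)) := by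
          rw [← mul_assoc, ← mul_pow, ← hut]
      _ ≤ (N / a) ^ 2 * (8 * Real.exp (t / 2) * Real.exp (t / 2)) := by gcongr
      _ = _ := by rw [mul_assoc 8, hhalf]; ring

/-- If the mean oscillation of `log A` over the subballs of a ball is at most `N`, with `N` small,
then `A` is integrable on the ball and its weighted quadratic oscillation is of order `N ^ 2`. -/
theorem exists_weighted_oscillation_le (n : ℕ) [NeZero n] :
    ∃ K : ℝ, 0 < K ∧ ∃ δ : ℝ, 0 < δ ∧
      ∀ A : EuclideanSpace ℝ (Fin n) → Matrix (Fin n) (Fin n) ℝ, IsMatrixWeight A →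
        LocallyIntegrable (logWeight A) volume →
        ∀ (y : EuclideanSpace ℝ (Fin n)) (r N : ℝ), 0 < r → 0 < N → N ≤ δ →
          bmoSeminorm (logWeight A) (ball y r) ≤ ENNReal.ofReal N →
          IntegrableOn A (ball y r) ∧
          ∫⁻ x in ball y r, ‖A x - ⨍ z in ball y r, A z‖ₑ ^ 2 * ‖A x‖ₑ⁻¹
            ≤ ENNReal.ofReal (K * N ^ 2) * normWeightMass A (ball y r) := by
  obtain ⟨C, hC⟩ := exists_lintegral_exp_div_le (E := Matrix (Fin n) (Fin n) ℝ)
    (volume : Measure (EuclideanSpace ℝ (Fin n)))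
  set a := jnExponent (Module.finrank ℝ (EuclideanSpace ℝ (Fin n)))
  have ha : 0 < a := jnExponent_pos _
  -- The bound `a / 6` on `N` allows John–Nirenberg to absorb `exp (3 * u)`, and `1 / 2` gives the
  -- lower bound on the mass; the `+ 1` ensures positivity even if `C = 0`.
  refine ⟨4 * (8 + 4 * C ^ 2) * C / a ^ 2 + 1, by positivity, min (a / 6) (1 / 2), by positivity,
    fun A hA hlog y r N hr hN hNδ hbmo => ?_⟩
  have hNa : N ≤ a / 6 := hNδ.trans (min_le_left _ _)
  have hN2 : N ≤ 1 / 2 := hNδ.trans (min_le_right _ _)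
  set B := ball y r with hB
  have hB0 : volume B ≠ 0 := (measure_ball_pos volume y hr).ne'
  have hBt : volume B ≠ ∞ := measure_ball_lt_top.ne
  set h := ⨍ z in B, logWeight A z with hh
  have hsa : IsSelfAdjoint h := IsSelfAdjoint.setAverage (logWeight_isSelfAdjoint A) _
  set α := ‖NormedSpace.exp h‖ with hα
  have hα0 : 0 < α := Matrix.norm_exp_pos hsa
  let u : EuclideanSpace ℝ (Fin n) → ℝ := fun x => ‖logWeight A x - h‖
  let Φ : EuclideanSpace ℝ (Fin n) → ℝ := fun x => Real.exp (a * (u x / N))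
  have hu0 : ∀ x, 0 ≤ u x := fun x => norm_nonneg _
  have hΦ : ∫⁻ x in B, ENNReal.ofReal (Φ x) ≤ C * volume B :=
    hC (logWeight A) hlog y r N hr hN fun x s hs hx => setLIntegral_le_of_bmoSeminorm_le hbmo hs hx
  have hΦc : ∀ c : ℝ, 0 ≤ c → ∫⁻ x in B, ENNReal.ofReal (c * Φ x)
      ≤ ENNReal.ofReal c * (C * volume B) := by
    intro c hc
    simp only [ENNReal.ofReal_mul hc]
    rw [lintegral_const_mul' _ _ ENNReal.ofReal_ne_top]
    gcongr
  have hbd := fun x => mul_exp_bounds ha hN hNa (hu0 x)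
  have hpt : ∀ᵐ x, ‖A x‖ ≤ α * Real.exp (u x) ∧ α ≤ Real.exp (u x) * ‖A x‖ ∧
      ‖A x - NormedSpace.exp h‖ ≤ α * (u x * Real.exp (u x)) := by
    filter_upwards [hA.posDef_ae] with x hx
    have hs := logWeight_isSelfAdjoint A x
    have h1 := Matrix.norm_exp_le_exp_norm_sub_mul hs hsa
    have h2 := Matrix.norm_exp_le_exp_norm_sub_mul hsa hs
    have h3 := Matrix.norm_exp_sub_exp_le hs hsa
    rw [norm_sub_rev] at h2
    rw [exp_logWeight hx] at h1 h2 h3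
    exact ⟨by rwa [mul_comm], h2, by rwa [mul_comm]⟩
  have hAint : IntegrableOn A B := by
    refine ⟨hA.aestronglyMeasurable.restrict, ?_⟩
    calc ∫⁻ x in B, ‖A x‖ₑ ≤ ∫⁻ x in B, ENNReal.ofReal (α * Φ x) := by
          refine lintegral_mono_ae (ae_restrict_of_ae ?_)
          filter_upwards [hpt] with x hx
          rw [← ofReal_norm]
          exact ENNReal.ofReal_le_ofReal
            (hx.1.trans (mul_le_mul_of_nonneg_left (hbd x).1 hα0.le))
      _ ≤ ENNReal.ofReal α * (C * volume B) := hΦc α hα0.le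
      _ < ∞ := ENNReal.mul_lt_top ENNReal.ofReal_lt_top
          (ENNReal.mul_lt_top ENNReal.coe_lt_top hBt.lt_top)
  refine ⟨hAint, ?_⟩
  set M := ⨍ z in B, A z with hM
  have hMh : ‖M - NormedSpace.exp h‖ ≤ α * (2 * N / a * C) := by
    have h1 : ‖M - NormedSpace.exp h‖ₑ * volume B
        ≤ ENNReal.ofReal (α * (2 * N / a)) * (C * volume B) := by
      refine (enorm_setAverage_sub_mul_le volume hAint hBt _).trans
        (le_trans ?_ (hΦc (α * (2 * N / a)) (by positivity)))
      refine lintegral_mono_ae (ae_restrict_of_ae ?_)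
      filter_upwards [hpt] with x hx
      rw [← ofReal_norm]
      refine ENNReal.ofReal_le_ofReal (hx.2.2.trans ?_)
      rw [mul_assoc]
      exact mul_le_mul_of_nonneg_left (hbd x).2.1 hα0.le
    rw [← mul_assoc] at h1
    have h2 := (ENNReal.mul_le_mul_iff_left hB0 hBt).1 h1
    rw [← ofReal_norm, ← ENNReal.ofReal_coe_nnreal, ← ENNReal.ofReal_mul (by positivity)] at h2
    rw [← mul_assoc]
    exact (ENNReal.ofReal_le_ofReal_iff (by positivity)).1 h2
  set κ := 2 * N / a * C with hκ
  have hκ0 : 0 ≤ κ := by positivity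
  have hosc : ∫⁻ x in B, ‖A x - M‖ₑ ^ 2 * ‖A x‖ₑ⁻¹
      ≤ ENNReal.ofReal (2 * α * (8 * N ^ 2 / a ^ 2 + κ ^ 2)) * (C * volume B) := by
    refine le_trans ?_ (hΦc _ (by positivity))
    refine lintegral_mono_ae (ae_restrict_of_ae ?_)
    filter_upwards [hpt] with x hx
    obtain ⟨-, h2, h3⟩ := hx
    have hA0 : 0 < ‖A x‖ := by
      by_contra hcon
      have : ‖A x‖ = 0 := le_antisymm (not_lt.1 hcon) (norm_nonneg _)
      rw [this, mul_zero] at h2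
      linarith
    have hinv : ‖A x‖⁻¹ ≤ Real.exp (u x) / α := by
      rw [inv_le_comm₀ hA0 (by positivity), inv_div, div_le_iff₀ (Real.exp_pos _), mul_comm]
      exact h2
    rw [← ofReal_norm, ← ofReal_norm, ← ENNReal.ofReal_inv_of_pos hA0,
      ← ENNReal.ofReal_pow (norm_nonneg _), ← ENNReal.ofReal_mul (by positivity)]
    apply ENNReal.ofReal_le_ofReal
    have h4 : ‖A x - M‖ ≤ α * (u x * Real.exp (u x) + κ) := by
      have := norm_sub_le_norm_sub_add_norm_sub (A x) (NormedSpace.exp h) M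
      rw [norm_sub_rev (NormedSpace.exp h) M] at this
      rw [mul_add]
      linarith
    have h5 : Real.exp (3 * u x) = Real.exp (u x) * Real.exp (u x) * Real.exp (u x) := by
      rw [← Real.exp_add, ← Real.exp_add]; ring_nf
    have hκ2 : 0 ≤ κ ^ 2 := by positivity
    calc ‖A x - M‖ ^ 2 * ‖A x‖⁻¹
        ≤ (α * (u x * Real.exp (u x) + κ)) ^ 2 * (Real.exp (u x) / α) := by gcongr
      _ = α * (u x * Real.exp (u x) + κ) ^ 2 * Real.exp (u x) := by field_simp
      _ ≤ α * (2 * ((u x * Real.exp (u x)) ^ 2 + κ ^ 2)) * Real.exp (u x) := by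
          gcongr
          nlinarith [sq_nonneg (u x * Real.exp (u x) - κ)]
      _ = 2 * α * (u x ^ 2 * Real.exp (3 * u x) + κ ^ 2 * Real.exp (u x)) := by rw [h5]; ring
      _ ≤ 2 * α * (8 * N ^ 2 / a ^ 2 * Φ x + κ ^ 2 * Φ x) :=
          mul_le_mul_of_nonneg_left (add_le_add (hbd x).2.2
            (mul_le_mul_of_nonneg_left (hbd x).1 hκ2)) (by positivity)
      _ = _ := by ring
  -- From `‖A‖ ≥ α exp (-u) ≥ α (1 - u)` and the mean of `u` being at most `N ≤ 1 / 2`.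
  have hmass : ENNReal.ofReal (α / 2) * volume B ≤ normWeightMass A B := by
    have h1 : ∫⁻ x in B, ENNReal.ofReal α
        ≤ ∫⁻ x in B, (ENNReal.ofReal α * ‖logWeight A x - h‖ₑ + ‖A x‖ₑ) := by
      refine lintegral_mono_ae (ae_restrict_of_ae ?_)
      filter_upwards [hpt] with x hx
      rw [← ofReal_norm, ← ofReal_norm, ← ENNReal.ofReal_mul hα0.le,
        ← ENNReal.ofReal_add (by positivity) (norm_nonneg _)]
      apply ENNReal.ofReal_le_ofReal
      change α ≤ α * u x + ‖A x‖
      have h3 : Real.exp (-u x) * α ≤ ‖A x‖ := by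
        rw [Real.exp_neg, inv_mul_le_iff₀ (Real.exp_pos _)]
        exact hx.2.1
      nlinarith [Real.add_one_le_exp (-u x)]
    rw [setLIntegral_const, lintegral_add_right' _ hA.aestronglyMeasurable.enorm.restrict,
      lintegral_const_mul' _ _ ENNReal.ofReal_ne_top] at h1
    have h2 : ENNReal.ofReal α * ∫⁻ x in B, ‖logWeight A x - h‖ₑ
        ≤ ENNReal.ofReal (α / 2) * volume B := by
      calc _ ≤ ENNReal.ofReal α * (ENNReal.ofReal (1 / 2) * volume B) := by
            gcongr
            exact (setLIntegral_le_of_bmoSeminorm_le hbmo hr subset_rfl).trans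
              (by gcongr)
        _ = _ := by rw [← mul_assoc, ← ENNReal.ofReal_mul hα0.le, mul_one_div]
    have h3 : ENNReal.ofReal α = ENNReal.ofReal (α / 2) + ENNReal.ofReal (α / 2) := by
      rw [← ENNReal.ofReal_add (by positivity) (by positivity), add_halves]
    rw [h3, add_mul, ← h3] at h1
    exact ENNReal.le_of_add_le_add_left (ENNReal.mul_ne_top ENNReal.ofReal_ne_top hBt)
      (h1.trans (by gcongr; exact le_rfl))
  calc _ ≤ _ := hosc
    _ = ENNReal.ofReal (4 * (8 + 4 * C ^ 2) * C / a ^ 2 * N ^ 2) *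
          (ENNReal.ofReal (α / 2) * volume B) := by
        rw [← mul_assoc, ← mul_assoc, ← ENNReal.ofReal_mul (by positivity),
          ← ENNReal.ofReal_coe_nnreal, ← ENNReal.ofReal_mul (by positivity)]
        congr 2
        rw [hκ]
        ring
    _ ≤ _ := by
        gcongr
        linarith

end MatrixWeights

/-! ### Passage to the seminorms. -/

theorem mainTheorem5 (n : ℕ) (hn : 1 ≤ n) (Λ : ℝ) (hΛ : 1 ≤ Λ) :
    ∃ δ : ℝ, 0 < δ ∧ ∃ c : ℝ, 0 < c ∧
      ∀ A : EuclideanSpace ℝ (Fin n) → Matrix (Fin n) (Fin n) ℝ,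
        IsMatrixWeight A →
        (∀ᵐ x, ‖A x‖ * ‖(A x)⁻¹‖ ≤ Λ ^ 2) →
        LocallyIntegrable (logWeight A) volume →
        bmoSeminorm (logWeight A) Set.univ ≤ ENNReal.ofReal δ →
          LocallyIntegrable A volume ∧
          (∀ (y : EuclideanSpace ℝ (Fin n)) (r : ℝ), 0 < r →
            (volume (ball y r) / normWeightMass A (ball y r) *
                ⨍⁻ x in ball y r, ‖A x - ⨍ z in ball y r, A z‖ₑ ^ 2 * ‖A x‖ₑ⁻¹ ∂volume) ^ (1 / 2 : ℝ)
              ≤ ENNReal.ofReal c * bmoSeminorm (logWeight A) (ball y r)) ∧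
          (∀ (y : EuclideanSpace ℝ (Fin n)) (r : ℝ), 0 < r →
            weightedBMOTwo A (ball y r)
              ≤ ENNReal.ofReal c * bmoSeminorm (logWeight A) (ball y r)) ∧
          weightedBMOTwo A Set.univ ≤ ENNReal.ofReal c * bmoSeminorm (logWeight A) Set.univ := by
  have : NeZero n := ⟨by omega⟩
  obtain ⟨K, hK, δ, hδ, hmain⟩ := exists_weighted_oscillation_le n
  have hc : 0 < √K := Real.sqrt_pos.2 hK
  -- Halving `δ` leaves room to enlarge the seminorm slightly and still satisfy the smallness
  -- condition.
  refine ⟨δ / 2, by positivity, √K, hc, fun A hA _ hlog hbmo => ?_⟩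
  have hbmo' : ∀ (y : EuclideanSpace ℝ (Fin n)) (r : ℝ),
      bmoSeminorm (logWeight A) (ball y r) ≤ ENNReal.ofReal (δ / 2) := fun y r =>
    (bmoSeminorm_mono _ (Set.subset_univ _)).trans hbmo
  have hint : ∀ (y : EuclideanSpace ℝ (Fin n)) (r : ℝ), 0 < r → IntegrableOn A (ball y r) :=
    fun y r hr => (hmain A hA hlog y r (δ / 2) hr (by positivity) (by linarith) (hbmo' y r)).1
  have hosc : ∀ (y : EuclideanSpace ℝ (Fin n)) (r : ℝ), 0 < r →
      (1 / normWeightMass A (ball y r) *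
        ∫⁻ x in ball y r, ‖A x - ⨍ z in ball y r, A z‖ₑ ^ 2 * ‖A x‖ₑ⁻¹) ^ (1 / 2 : ℝ)
        ≤ ENNReal.ofReal √K * bmoSeminorm (logWeight A) (ball y r) := by
    intro y r hr
    obtain ⟨β, hβ⟩ : ∃ β : NNReal, bmoSeminorm (logWeight A) (ball y r) = β :=
      ⟨_, (ENNReal.coe_toNNReal ((hbmo' y r).trans_lt ENNReal.ofReal_lt_top).ne).symm⟩
    have hβδ : (β : ℝ) ≤ δ / 2 := by
      have := hbmo' y r
      rw [hβ, ← ENNReal.ofReal_coe_nnreal] at this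
      exact (ENNReal.ofReal_le_ofReal_iff (by positivity)).1 this
    refine ENNReal.le_of_forall_pos_le_add fun ε hε _ => ?_
    have hε' : (0 : ℝ) < ε := hε
    -- The local estimate needs a strictly positive `N`, whereas `β` may vanish; the excess over `β`
    -- contributes at most `ε` after multiplication by `√K`.
    set N : ℝ := β + min (δ / 2) (ε / √K) with hN
    have hmin : 0 < min (δ / 2) (ε / √K) := by positivity
    have hN0 : 0 < N := by positivity
    have hNδ : N ≤ δ := by linarith [min_le_left (δ / 2) (ε / √K)]
    obtain ⟨-, h2⟩ := hmain A hA hlog y r N hr hN0 hNδ (by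
      rw [hβ, ← ENNReal.ofReal_coe_nnreal]
      exact ENNReal.ofReal_le_ofReal (by linarith))
    have h3 : 1 / normWeightMass A (ball y r) *
        ∫⁻ x in ball y r, ‖A x - ⨍ z in ball y r, A z‖ₑ ^ 2 * ‖A x‖ₑ⁻¹
        ≤ ENNReal.ofReal (√K * N) ^ 2 := by
      rw [← ENNReal.ofReal_pow (by positivity), mul_pow, Real.sq_sqrt hK.le, mul_comm, mul_one_div]
      exact ENNReal.div_le_of_le_mul h2
    calc _ ≤ (ENNReal.ofReal (√K * N) ^ 2) ^ (1 / 2 : ℝ) := by gcongr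
      _ = ENNReal.ofReal (√K * N) := by
          rw [← ENNReal.rpow_natCast, ← ENNReal.rpow_mul]; norm_num
      _ ≤ ENNReal.ofReal (√K * β + ε) := by
          apply ENNReal.ofReal_le_ofReal
          have : √K * min (δ / 2) (ε / √K) ≤ √K * (ε / √K) := by gcongr; exact min_le_right _ _
          rw [mul_div_cancel₀ _ hc.ne'] at this
          rw [hN, mul_add]
          linarith
      _ = _ := by
          rw [ENNReal.ofReal_add (by positivity) hε'.le, ENNReal.ofReal_mul hc.le,
            ENNReal.ofReal_coe_nnreal, ENNReal.ofReal_coe_nnreal, hβ]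
  have hsup : ∀ U : Set (EuclideanSpace ℝ (Fin n)),
      weightedBMOTwo A U ≤ ENNReal.ofReal √K * bmoSeminorm (logWeight A) U := fun U =>
    iSup_le fun y => iSup_le fun r => iSup_le fun hr => iSup_le fun hy =>
      (hosc y r hr).trans (by gcongr; exact bmoSeminorm_mono _ hy)
  refine ⟨fun x => ⟨ball x 1, ball_mem_nhds x one_pos, hint x 1 one_pos⟩, fun y r hr => ?_,
    fun y r _ => hsup _, hsup _⟩
  convert hosc y r hr using 2
  rw [setLAverage_eq, div_eq_mul_inv, div_eq_mul_inv, one_div, mul_comm (volume _), mul_assoc]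
  congr 1
  rw [mul_comm, mul_assoc, ENNReal.inv_mul_cancel (measure_ball_pos volume y hr).ne'
    measure_ball_lt_top.ne, mul_one]
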